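/- Let $(V,d)$ be a finite metric space with $n$ points and diameter $M$, and let $k\ge 1$. For finite $U\subseteq V$ and a set $C\subseteq V$ of $k$ centers put $\mathrm{cost}_{\mathrm{avg}}(U,C)=\frac1{|U|}\sum_{v\in U}d(v,C)$ (and $0$ if $U=\emptyset$), and let $\mathrm{med}_{\mathrm{avg}}(U,k)=\min_{C\subseteq V,\,|C|=k}\mathrm{cost}_{\mathrm{avg}}(U,C)$. A randomized algorithm $\mathcal A$ on subsets of $V$ is $\varepsilon$-DP if $\Pr[\mathcal A(D)\in T]\le e^{\varepsilon}\Pr[\mathcal A(D')\in T]$ for every set $T$ of outcomes whenever one of $D,D'$ arises from the other by adding one point. Given $\mathcal A$ and $\xi\in[0,1]$, let $\mathcal A'$ be the algorithm that on input $D\subseteq V$ draws $S\subseteq D$ by including each element of $D$ independently with probability $\xi$, and outputs $C^*=\mathcal A(S)$. **Theorem.** There is an absolute constant $c>0$ such that the following holds for all $(V,d)$, $k$ as above, all $\varepsilon>0$, $\eta>0$, $0<\theta<1$, $\xi\in[0,1]$, $\beta\ge 0$ and $K\ge 0$. Let $\mathcal A$ be an $\varepsilon$-DP $(6,\gamma)$-approximation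 $k$-median algorithm with $\gamma=K\,Mk^2\log^2(n/\varepsilon)$ and failure probability $\beta$; that is, on every input $S\subseteq V$ it outputs a set $C$ of $k$ centers, and with probability at least $1-\beta$ this $C$ satisfies $\mathrm{cost}_{\mathrm{avg}}(S,C)\le 6\,\mathrm{med}_{\mathrm{avg}}(S,k)+\gamma$. Then $\mathcal A'$ is $\varepsilon'$-DP with $$\varepsilon'=\ln\max\Big\{\xi(e^{\varepsilon}-1)+1,\ \big(\xi(e^{-\varepsilon}-1)+1\big)^{-1}\Big\}.$$ Moreover, put $$s_0=c\cdot\max\Big\{\frac{M\ln(1/\theta)}{\eta},\ \Big(\frac M\eta\Big)^2\Big(k\ln n+\ln\frac1\theta\Big)\Big\}.$$ For every $D\subseteq V$, the output $C^*$ of $\mathcal A'(D)$ satisfies $$\mathrm{cost}_{\mathrm{avg}}(D,C^*)\le 6\,\mathrm{med}_{\mathrm{avg}}(D,k)+K\,Mk^2\log^2(n/\varepsilon)+\eta$$ with probability at least $1-\theta-\beta$ in each of the following two situations: (i) if the expected sample size $\xi|D|$ is at least $s_0$; (ii) for arbitrary $\xi$, conditionally on $|S|=s$, for every integer $s\ge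 s_0$ with $\Pr[|S|=s]>0$. -/

import Mathlib

open scoped ENNReal

noncomputable section

/-- A clustering with `k` centers: a set of exactly `k` points of the space. -/
abbrev Centers (V : Type*) (k : ℕ) : Type _ := {C : Finset V // C.card = k}

/-- Average `k`-median cost of the points `U` with respect to the centers `C`:
`(1 / |U|) * ∑_{v ∈ U} d(v, C)`. -/
def costAvg {V : Type*} [MetricSpace V] {k : ℕ} (U : Finset V) (C : Centers V k) : ℝ :=
  (1 / (U.card : ℝ)) * ∑ v ∈ U, Metric.infDist v (C.1 : Set V)

/-- Average cost of an optimum `k`-median clustering of `D`, the centers ranging over all `k`-point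
subsets of the whole space: `(1 / |D|) * min_{C ⊆ V, |C| = k} ∑_{x ∈ D} d(x, C)`.
The infimum is over a finite family when the space is finite. -/
def medAvg {V : Type*} [MetricSpace V] (D : Finset V) (k : ℕ) : ℝ :=
  (1 / (D.card : ℝ)) * ⨅ C : Centers V k, ∑ x ∈ D, Metric.infDist x (C.1 : Set V)

/-- `C` is a `(ρ, φ)`-good solution of the `k`-median problem on `D`. -/
def IsGoodSolution {V : Type*} [MetricSpace V] {k : ℕ} (ρ φ : ℝ) (D : Finset V)
    (C : Centers V k) : Prop :=
  costAvg D C ≤ ρ * medAvg D k + φ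

/-- A guarantee on total costs with additive error `φ` gives the same guarantee on average costs. -/
theorem isGoodSolution_of_sum_le {V : Type*} [MetricSpace V] {k : ℕ} {ρ φ : ℝ} (hφ : 0 ≤ φ)
    {D : Finset V} {C : Centers V k}
    (h : ∑ v ∈ D, Metric.infDist v (C.1 : Set V) ≤
      ρ * (⨅ C' : Centers V k, ∑ x ∈ D, Metric.infDist x (C'.1 : Set V)) + φ) :
    IsGoodSolution ρ φ D C := by
  unfold IsGoodSolution costAvg medAvg
  rcases D.eq_empty_or_nonempty with rfl | hD
  · simpa using hφ
  · have h1 : (1 : ℝ) ≤ D.card := by exact_mod_cast hD.card_pos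
    have h2 : (0 : ℝ) ≤ 1 / (D.card : ℝ) := by positivity
    have h3 : 1 / (D.card : ℝ) ≤ 1 := by
      rw [div_le_one (by linarith)]
      exact h1
    nlinarith [mul_le_mul_of_nonneg_left h h2, mul_le_mul_of_nonneg_right h3 hφ]

/-- `ε`-differential privacy of a randomized algorithm on finite data sets. Neighbouring data sets
are `D` and `D ∪ {x}` with `x ∉ D`, and both inequalities are required for every set of outcomes. -/
def IsDifferentiallyPrivate {V Ω : Type*} (ε : ℝ) (A : Finset V → PMF Ω) : Prop :=
  ∀ (D : Finset V) (x : V) (hx : x ∉ D) (T : Set Ω),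
    (A (D.cons x hx)).toOuterMeasure T ≤
        ENNReal.ofReal (Real.exp ε) * (A D).toOuterMeasure T ∧
      (A D).toOuterMeasure T ≤
        ENNReal.ofReal (Real.exp ε) * (A (D.cons x hx)).toOuterMeasure T

/-- `A` is an `(α, γ)`-approximation algorithm for `k`-median except with probability `β`: on every
input its output is an `(α, γ)`-good solution with probability at least `1 - β`. -/
def IsApproxAlgorithm {V : Type*} [MetricSpace V] {k : ℕ} (α γ β : ℝ)
    (A : Finset V → PMF (Centers V k)) : Prop :=
  ∀ S : Finset V,
    ENNReal.ofReal (1 - β) ≤ (A S).toOuterMeasure {C | IsGoodSolution α γ S C}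

open Classical in
/-- The random subset of `D` that contains each element of `D` independently with probability `ξ`:
a set `S ⊆ D` has probability `ξ ^ |S| * (1 - ξ) ^ (|D| - |S|)`. -/
def bernoulliSample {V : Type*} (ξ : ℝ) (hξ : ξ ∈ Set.Icc (0 : ℝ) 1) (D : Finset V) :
    PMF (Finset V) :=
  PMF.ofFinset
    (fun S => if S ⊆ D then
      ENNReal.ofReal ξ ^ S.card * ENNReal.ofReal (1 - ξ) ^ (D.card - S.card) else 0)
    D.powerset
    (by
      rw [Finset.sum_congr rfl (fun S hS => if_pos (Finset.mem_powerset.mp hS)),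
        Finset.sum_pow_mul_eq_add_pow,
        ← ENNReal.ofReal_add hξ.1 (sub_nonneg.mpr hξ.2)]
      simp)
    (fun S hS => if_neg (fun h => hS (Finset.mem_powerset.mpr h)))

/-- The sampling scheme run on `D`: draw the sample `S`, run `A` on `S`, and record the pair of the
sample `S` and the output `C` of `A`. -/
def samplingRun {V Ω : Type*} (A : Finset V → PMF Ω) (ξ : ℝ) (hξ : ξ ∈ Set.Icc (0 : ℝ) 1)
    (D : Finset V) : PMF (Finset V × Ω) :=
  (bernoulliSample ξ hξ D).bind fun S => (A S).map fun C => (S, C)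

/-- The algorithm `A'`: the sampling scheme, of which only the output of `A` on the sample is
published. -/
def samplingAlgorithm {V Ω : Type*} (A : Finset V → PMF Ω) (ξ : ℝ)
    (hξ : ξ ∈ Set.Icc (0 : ℝ) 1) (D : Finset V) : PMF Ω :=
  (samplingRun A ξ hξ D).map Prod.snd

/-- The privacy parameter `ε'` of the sampling scheme run with an `ε`-private algorithm. -/
def amplifiedEps (ε ξ : ℝ) : ℝ :=
  Real.log (max (ξ * (Real.exp ε - 1) + 1) (ξ * (Real.exp (-ε) - 1) + 1)⁻¹)

/-- The quantity `max {M ln(1/θ) / η, (M/η)² (k ln n + ln(1/θ))}`. -/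
def sampleBound (M η θ : ℝ) (n k : ℕ) : ℝ :=
  max (M * Real.log (1 / θ) / η) ((M / η) ^ 2 * (k * Real.log n + Real.log (1 / θ)))

end

/-!
Privacy. Splitting the samples of `D ∪ {x}` according to whether they contain `x` shows that the
output distribution on `D ∪ {x}` is the mixture, with weights `1 - ξ` and `ξ`, of the average of
`A S` and the average of `A (S ∪ {x})` over samples `S` of `D`
(`sum_powerset_cons_sampleWeight`). The `ε`-privacy of `A` compares the two averages, which gives
the factors `ξ (e ^ ε - 1) + 1` and `ξ (e ^ (-ε) - 1) + 1`.

Accuracy. If `η > M` every choice of centers is good, since no average cost exceeds `M`. Otherwise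
call a sample `S` representative when it is nonempty and, for each `C`, the average costs of `C`
on `S` and on `D` differ by at most `η / 7`. A good solution on a representative sample is good
on `D` with additional error `η / 7 + 6 * η / 7 = η`
(`RepresentativeSample.costAvg_le`), so it suffices to bound the weight of the samples
that are not representative.

For a fixed `C` let `h v` be `d(v, C)` minus its mean over `D`. The sample deviates upwards by `t`
exactly if `∑ v ∈ S, (h v - t) ≥ 0`, and this sum has an explicit exponential moment under
Bernoulli sampling, because the elements are included independently
(`sum_sampleWeight_deviation_le`). The random size of the sample therefore needs no separate
treatment. A union bound over the at most `n ^ k` choices of `C` and the two signs settles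
sampling with expected size `ξ |D|`.

For a sample of fixed size `s` the same bound is used with `p = s / |D|` in place of `ξ`:
conditionally on their size, samples are uniform whatever the inclusion probability is, and `s` is
the mode of the binomial distribution with mean `s`, so that conditioning costs at most a factor
`|D| + 1 ≤ n + 1` (`one_le_card_succ_mul_binomial`). The term `k * log n` in the sample bound
absorbs this factor, as it absorbs the factor `2` from the two signs.
-/

/-! ### Bernoulli sampling as a finite weighted sum -/

/-- The probability that Bernoulli sampling with inclusion probability `p` draws the subset `S`
of `D`. -/
noncomputable def sampleWeight {V : Type*} (p : ℝ) (D S : Finset V) : ℝ :=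
  p ^ S.card * (1 - p) ^ (D.card - S.card)

/-- The probability of the event `T`, as a real number. -/
noncomputable def PMF.realProb {Ω : Type*} (q : PMF Ω) (T : Set Ω) : ℝ :=
  (q.toOuterMeasure T).toReal

theorem PMF.toOuterMeasure_apply_le_one {Ω : Type*} (q : PMF Ω) (T : Set Ω) :
    q.toOuterMeasure T ≤ 1 := by
  rw [q.toOuterMeasure_apply, ← q.tsum_coe]
  exact ENNReal.tsum_le_tsum fun x => Set.indicator_le_self' (fun _ _ => zero_le) x

theorem PMF.ofReal_realProb {Ω : Type*} (q : PMF Ω) (T : Set Ω) :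
    ENNReal.ofReal (q.realProb T) = q.toOuterMeasure T :=
  ENNReal.ofReal_toReal ((q.toOuterMeasure_apply_le_one T).trans_lt ENNReal.one_lt_top).ne

theorem PMF.realProb_nonneg {Ω : Type*} (q : PMF Ω) (T : Set Ω) : 0 ≤ q.realProb T :=
  ENNReal.toReal_nonneg

theorem sampleWeight_nonneg {V : Type*} {p : ℝ} (hp : p ∈ Set.Icc (0 : ℝ) 1) (D S : Finset V) :
    0 ≤ sampleWeight p D S :=
  mul_nonneg (pow_nonneg hp.1 _) (pow_nonneg (sub_nonneg.mpr hp.2) _)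

theorem sum_sampleWeight {V : Type*} (p : ℝ) (D : Finset V) :
    ∑ S ∈ D.powerset, sampleWeight p D S = 1 := by
  simp [sampleWeight, Finset.sum_pow_mul_eq_add_pow]

theorem samplingRun_toOuterMeasure {V Ω : Type*} (A : Finset V → PMF Ω) (ξ : ℝ)
    (hξ : ξ ∈ Set.Icc (0 : ℝ) 1) (D : Finset V) (T : Set (Finset V × Ω)) :
    (samplingRun A ξ hξ D).toOuterMeasure T =
      ENNReal.ofReal (∑ S ∈ D.powerset, sampleWeight ξ D S * (A S).realProb {C | (S, C) ∈ T}) := by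
  classical
  rw [samplingRun, PMF.toOuterMeasure_bind_apply, tsum_eq_sum (s := D.powerset)]
  · rw [ENNReal.ofReal_sum_of_nonneg fun S _ =>
      mul_nonneg (sampleWeight_nonneg hξ D S) ((A S).realProb_nonneg _)]
    refine Finset.sum_congr rfl fun S hS => ?_
    rw [ENNReal.ofReal_mul (sampleWeight_nonneg hξ D S), PMF.ofReal_realProb,
      PMF.toOuterMeasure_map_apply, sampleWeight,
      ENNReal.ofReal_mul (pow_nonneg hξ.1 _), ENNReal.ofReal_pow hξ.1,
      ENNReal.ofReal_pow (sub_nonneg.mpr hξ.2)]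
    congr 1
    simp [bernoulliSample, PMF.ofFinset_apply, Finset.mem_powerset.mp hS]
  · intro S hS
    rw [Finset.mem_powerset] at hS
    simp [bernoulliSample, PMF.ofFinset_apply, hS]

theorem samplingAlgorithm_toOuterMeasure {V Ω : Type*} (A : Finset V → PMF Ω) (ξ : ℝ)
    (hξ : ξ ∈ Set.Icc (0 : ℝ) 1) (D : Finset V) (T : Set Ω) :
    (samplingAlgorithm A ξ hξ D).toOuterMeasure T =
      ENNReal.ofReal (∑ S ∈ D.powerset, sampleWeight ξ D S * (A S).realProb T) := by
  rw [samplingAlgorithm, PMF.toOuterMeasure_map_apply, samplingRun_toOuterMeasure]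
  rfl

/-! ### Privacy amplification by sampling -/

/-- A sample of `D ∪ {x}` is a sample `S` of `D` with probability `1 - ξ`, and `S ∪ {x}` for such
an `S` with probability `ξ`. -/
theorem sum_powerset_cons_sampleWeight {V : Type*} [DecidableEq V] (ξ : ℝ) (D : Finset V) (x : V)
    (hx : x ∉ D) (a : Finset V → ℝ) :
    ∑ S ∈ (D.cons x hx).powerset, sampleWeight ξ (D.cons x hx) S * a S =
      ∑ S ∈ D.powerset, sampleWeight ξ D S * ((1 - ξ) * a S + ξ * a (insert x S)) := by
  rw [Finset.cons_eq_insert, Finset.sum_powerset_insert hx, ← Finset.sum_add_distrib]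
  refine Finset.sum_congr rfl fun S hS => ?_
  have hSD := Finset.mem_powerset.mp hS
  have hle := Finset.card_le_card hSD
  rw [sampleWeight, sampleWeight, sampleWeight, Finset.card_insert_of_notMem hx,
    Finset.card_insert_of_notMem fun h => hx (hSD h), Nat.add_sub_add_right,
    Nat.sub_add_comm hle]
  ring

theorem IsDifferentiallyPrivate.realProb_le {V Ω : Type*} {ε : ℝ} {A : Finset V → PMF Ω}
    (hA : IsDifferentiallyPrivate ε A) {S : Finset V} {x : V} (hx : x ∉ S) (T : Set Ω) :
    (A (S.cons x hx)).realProb T ≤ Real.exp ε * (A S).realProb T ∧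
      (A S).realProb T ≤ Real.exp ε * (A (S.cons x hx)).realProb T := by
  have h := hA S x hx T
  rw [← PMF.ofReal_realProb, ← PMF.ofReal_realProb, ← ENNReal.ofReal_mul (Real.exp_pos _).le,
    ← ENNReal.ofReal_mul (Real.exp_pos _).le] at h
  exact ⟨(ENNReal.ofReal_le_ofReal_iff
      (mul_nonneg (Real.exp_pos _).le (PMF.realProb_nonneg _ _))).mp h.1,
    (ENNReal.ofReal_le_ofReal_iff
      (mul_nonneg (Real.exp_pos _).le (PMF.realProb_nonneg _ _))).mp h.2⟩

theorem amplification_factor_pos {ε ξ : ℝ} (hξ : ξ ∈ Set.Icc (0 : ℝ) 1) :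
    0 < ξ * (Real.exp (-ε) - 1) + 1 := by
  rcases hξ.1.eq_or_lt with h | h
  · simp [← h]
  · nlinarith [mul_pos h (Real.exp_pos (-ε)), hξ.2]

theorem isDifferentiallyPrivate_samplingAlgorithm {V Ω : Type*} {ε : ℝ} {A : Finset V → PMF Ω}
    (hA : IsDifferentiallyPrivate ε A) {ξ : ℝ} (hξ : ξ ∈ Set.Icc (0 : ℝ) 1) :
    IsDifferentiallyPrivate (amplifiedEps ε ξ) (samplingAlgorithm A ξ hξ) := by
  classical
  intro D x hx T
  have hpos := amplification_factor_pos (ε := ε) hξ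
  rw [samplingAlgorithm_toOuterMeasure, samplingAlgorithm_toOuterMeasure,
    sum_powerset_cons_sampleWeight, amplifiedEps,
    Real.exp_log (lt_of_lt_of_le (inv_pos.mpr hpos) (le_max_right _ _))]
  have hmax : 0 ≤ max (ξ * (Real.exp ε - 1) + 1) (ξ * (Real.exp (-ε) - 1) + 1)⁻¹ :=
    (inv_pos.mpr hpos).le.trans (le_max_right _ _)
  rw [← ENNReal.ofReal_mul hmax, ← ENNReal.ofReal_mul hmax]
  have hDP : ∀ S ∈ D.powerset,
      (A (insert x S)).realProb T ≤ Real.exp ε * (A S).realProb T ∧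
        (A S).realProb T ≤ Real.exp ε * (A (insert x S)).realProb T := by
    intro S hS
    have hxS : x ∉ S := fun h => hx (Finset.mem_powerset.mp hS h)
    simpa only [Finset.cons_eq_insert] using hA.realProb_le hxS T
  constructor
  · apply ENNReal.ofReal_le_ofReal
    rw [Finset.mul_sum]
    refine Finset.sum_le_sum fun S hS => ?_
    have h0 := (A S).realProb_nonneg T
    have h1 : (1 - ξ) * (A S).realProb T + ξ * (A (insert x S)).realProb T ≤
        (ξ * (Real.exp ε - 1) + 1) * (A S).realProb T := by
      nlinarith [mul_le_mul_of_nonneg_left (hDP S hS).1 hξ.1]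
    calc _ ≤ sampleWeight ξ D S *
          (max (ξ * (Real.exp ε - 1) + 1) (ξ * (Real.exp (-ε) - 1) + 1)⁻¹ * (A S).realProb T) :=
          mul_le_mul_of_nonneg_left
            (h1.trans (mul_le_mul_of_nonneg_right (le_max_left _ _) h0))
            (sampleWeight_nonneg hξ D S)
      _ = _ := by ring
  · apply ENNReal.ofReal_le_ofReal
    rw [Finset.mul_sum]
    refine Finset.sum_le_sum fun S hS => ?_
    have h0 := (A S).realProb_nonneg T
    have h0' := (A (insert x S)).realProb_nonneg T
    have h1 : Real.exp (-ε) * (A S).realProb T ≤ (A (insert x S)).realProb T := by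
      rw [Real.exp_neg, inv_mul_le_iff₀ (Real.exp_pos _)]
      exact (hDP S hS).2
    have h2 : (ξ * (Real.exp (-ε) - 1) + 1) * (A S).realProb T ≤
        (1 - ξ) * (A S).realProb T + ξ * (A (insert x S)).realProb T := by
      nlinarith [mul_le_mul_of_nonneg_left h1 hξ.1]
    have h3 : (A S).realProb T ≤ (ξ * (Real.exp (-ε) - 1) + 1)⁻¹ *
        ((1 - ξ) * (A S).realProb T + ξ * (A (insert x S)).realProb T) := by
      rwa [le_inv_mul_iff₀ hpos]
    have h4 : 0 ≤ (1 - ξ) * (A S).realProb T + ξ * (A (insert x S)).realProb T :=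
      add_nonneg (mul_nonneg (sub_nonneg.mpr hξ.2) h0) (mul_nonneg hξ.1 h0')
    calc _ ≤ sampleWeight ξ D S *
          (max (ξ * (Real.exp ε - 1) + 1) (ξ * (Real.exp (-ε) - 1) + 1)⁻¹ *
            ((1 - ξ) * (A S).realProb T + ξ * (A (insert x S)).realProb T)) :=
          mul_le_mul_of_nonneg_left
            (h3.trans (mul_le_mul_of_nonneg_right (le_max_right _ _) h4))
            (sampleWeight_nonneg hξ D S)
      _ = _ := by ring

/-! ### A Chernoff bound for the mean of a Bernoulli sample -/

theorem sum_sampleWeight_mul_prod {V : Type*} [DecidableEq V] (p : ℝ) (D : Finset V) (x : V → ℝ) :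
    ∑ S ∈ D.powerset, sampleWeight p D S * ∏ v ∈ S, x v = ∏ v ∈ D, (p * x v + (1 - p)) := by
  rw [Finset.prod_add]
  refine Finset.sum_congr rfl fun S hS => ?_
  rw [Finset.prod_mul_distrib, Finset.prod_const, Finset.prod_const,
    Finset.card_sdiff_of_subset (Finset.mem_powerset.mp hS), sampleWeight]
  ring

/-- The probability that the mean of `h` over a Bernoulli sample exceeds its mean `0` over `D` by at
least `t`. The event is written without division, so it includes the empty sample. -/
theorem sum_sampleWeight_deviation_le {V : Type*} {p : ℝ} (hp : p ∈ Set.Icc (0 : ℝ) 1)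
    (D : Finset V) (h : V → ℝ) {M t : ℝ} (ht : 0 < t) (htM : t ≤ M)
    (hM : ∀ v ∈ D, |h v| ≤ M) (hsum : ∑ v ∈ D, h v = 0) :
    ∑ S ∈ D.powerset with t * S.card ≤ ∑ v ∈ S, h v, sampleWeight p D S ≤
      Real.exp (-(p * D.card * t ^ 2 / (16 * M ^ 2))) := by
  classical
  have hM0 : 0 < M := ht.trans_le htM
  -- This `l` minimizes the resulting exponent `p * |D| * (-l * t + 4 * l ^ 2 * M ^ 2)`.
  obtain ⟨l, hl⟩ : ∃ l : ℝ, l = t / (8 * M ^ 2) := ⟨_, rfl⟩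
  have hl0 : 0 < l := by rw [hl]; positivity
  have hl1 : l * (2 * M) ≤ 1 := by
    rw [hl, div_mul_eq_mul_div, div_le_one (by positivity)]
    nlinarith
  have hfactor : ∀ v ∈ D, p * Real.exp (l * (h v - t)) + (1 - p) ≤
      Real.exp (p * (l * h v - l * t + 4 * l ^ 2 * M ^ 2)) := by
    intro v hv
    have habs : |h v - t| ≤ 2 * M := by
      have := abs_le.mp (hM v hv)
      exact abs_le.mpr ⟨by linarith [this.1], by linarith [this.2]⟩
    have hx1 : |l * (h v - t)| ≤ 1 := by
      rw [abs_mul, abs_of_pos hl0]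
      exact (mul_le_mul_of_nonneg_left habs hl0.le).trans hl1
    have hexp := (abs_le.mp (Real.abs_exp_sub_one_sub_id_le hx1)).2
    have hsq : (l * (h v - t)) ^ 2 ≤ 4 * l ^ 2 * M ^ 2 := by
      have := sq_le_sq' (abs_le.mp habs).1 (abs_le.mp habs).2
      nlinarith [sq_nonneg l]
    refine le_trans ?_ (Real.add_one_le_exp _)
    nlinarith [hp.1]
  calc ∑ S ∈ D.powerset with t * S.card ≤ ∑ v ∈ S, h v, sampleWeight p D S
      ≤ ∑ S ∈ D.powerset with t * S.card ≤ ∑ v ∈ S, h v,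
          sampleWeight p D S * ∏ v ∈ S, Real.exp (l * (h v - t)) := by
        refine Finset.sum_le_sum fun S hS => ?_
        refine le_mul_of_one_le_right (sampleWeight_nonneg hp D S) ?_
        rw [← Real.exp_sum, ← Finset.mul_sum, Finset.sum_sub_distrib, Finset.sum_const,
          nsmul_eq_mul]
        refine Real.one_le_exp (mul_nonneg hl0.le ?_)
        linarith [(Finset.mem_filter.mp hS).2, mul_comm t (S.card : ℝ)]
    _ ≤ ∑ S ∈ D.powerset, sampleWeight p D S * ∏ v ∈ S, Real.exp (l * (h v - t)) :=
        Finset.sum_le_sum_of_subset_of_nonneg (Finset.filter_subset _ _) fun S _ _ =>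
          mul_nonneg (sampleWeight_nonneg hp D S)
            (Finset.prod_nonneg fun v _ => (Real.exp_pos _).le)
    _ = ∏ v ∈ D, (p * Real.exp (l * (h v - t)) + (1 - p)) := sum_sampleWeight_mul_prod _ _ _
    _ ≤ ∏ v ∈ D, Real.exp (p * (l * h v - l * t + 4 * l ^ 2 * M ^ 2)) :=
        Finset.prod_le_prod (fun v _ => add_nonneg (mul_nonneg hp.1 (Real.exp_pos _).le)
          (sub_nonneg.mpr hp.2)) hfactor
    _ = Real.exp (-(p * D.card * t ^ 2 / (16 * M ^ 2))) := by
        rw [← Real.exp_sum]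
        congr 1
        rw [← Finset.mul_sum, Finset.sum_add_distrib, Finset.sum_sub_distrib, ← Finset.mul_sum,
          hsum, Finset.sum_const, Finset.sum_const, nsmul_eq_mul, nsmul_eq_mul, hl]
        field_simp
        ring

/-! ### The mode of the binomial distribution -/

/-- The terms of the expansion of `(s + (N - s)) ^ N` are largest at the index `s`. -/
theorem choose_mul_pow_mul_pow_le {N s : ℕ} (hs : s ≤ N) {j : ℕ} (hj : j ≤ N) :
    N.choose j * s ^ j * (N - s) ^ (N - j) ≤ N.choose s * s ^ s * (N - s) ^ (N - s) := by
  obtain ⟨r, rfl⟩ := Nat.exists_eq_add_of_le hs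
  rw [Nat.add_sub_cancel_left]
  have hup : ∀ i, i < s → (s + r).choose i * s ^ i * r ^ (s + r - i) ≤
      (s + r).choose (i + 1) * s ^ (i + 1) * r ^ (s + r - (i + 1)) := by
    intro i hi
    have hch := Nat.choose_succ_right_eq (s + r) i
    obtain ⟨e, rfl⟩ := Nat.exists_eq_add_of_lt hi
    rw [show i + e + 1 + r - i = e + 1 + r by omega] at hch ⊢
    rw [show i + e + 1 + r - (i + 1) = e + r by omega]
    refine Nat.le_of_mul_le_mul_right (c := i + 1) ?_ (Nat.succ_pos i)
    calc _ = (i + e + 1 + r).choose i * (i + e + 1) ^ i * r ^ (e + r) * (r * (i + 1)) := by ring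
      _ ≤ (i + e + 1 + r).choose i * (i + e + 1) ^ i * r ^ (e + r) *
          ((e + 1 + r) * (i + e + 1)) := by
        refine Nat.mul_le_mul_left _ ?_
        nlinarith [Nat.zero_le (e * r), Nat.zero_le (e * e), Nat.zero_le (e * i)]
      _ = ((i + e + 1 + r).choose i * (e + 1 + r)) * ((i + e + 1) ^ (i + 1) * r ^ (e + r)) := by
        ring
      _ = _ := by rw [← hch]; ring
  have hdown : ∀ i, s ≤ i → i < s + r →
      (s + r).choose (i + 1) * s ^ (i + 1) * r ^ (s + r - (i + 1)) ≤
        (s + r).choose i * s ^ i * r ^ (s + r - i) := by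
    intro i hi hir
    have hch := Nat.choose_succ_right_eq (s + r) i
    obtain ⟨e, rfl⟩ := Nat.exists_eq_add_of_le hi
    obtain ⟨f, rfl⟩ : ∃ f, r = e + f + 1 := ⟨r - e - 1, by omega⟩
    rw [show s + (e + f + 1) - (s + e) = f + 1 by omega] at hch ⊢
    rw [show s + (e + f + 1) - (s + e + 1) = f by omega]
    refine Nat.le_of_mul_le_mul_right (c := s + e + 1) ?_ (Nat.succ_pos (s + e))
    calc _ = ((s + (e + f + 1)).choose (s + e + 1) * (s + e + 1)) *
          (s ^ (s + e + 1) * (e + f + 1) ^ f) := by ring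
      _ = (s + (e + f + 1)).choose (s + e) * s ^ (s + e) * (e + f + 1) ^ f * ((f + 1) * s) := by
        rw [hch]; ring
      _ ≤ (s + (e + f + 1)).choose (s + e) * s ^ (s + e) * (e + f + 1) ^ f *
          ((e + f + 1) * (s + e + 1)) := by
        refine Nat.mul_le_mul_left _ (Nat.mul_le_mul ?_ ?_) <;> omega
      _ = _ := by ring
  have hres : r = s + r - s := by omega
  rcases le_total j s with hjs | hsj
  · have key : (s + r).choose j * s ^ j * r ^ (s + r - j) ≤
        (s + r).choose s * s ^ s * r ^ (s + r - s) := by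
      induction hjs using Nat.decreasingInduction with
      | self => exact le_rfl
      | of_succ i hi ih => exact (hup i hi).trans (ih (by omega))
    simpa [← hres] using key
  · have key : (s + r).choose j * s ^ j * r ^ (s + r - j) ≤
        (s + r).choose s * s ^ s * r ^ (s + r - s) := by
      induction j, hsj using Nat.le_induction with
      | base => exact le_rfl
      | succ i hi ih => exact (hdown i hi (by omega)).trans (ih (by omega))
    simpa [← hres] using key

/-- A binomial variable with integral mean `s` takes the value `s`, its mode, with probability at
least `1 / (N + 1)`. -/
theorem one_le_card_succ_mul_binomial {N s : ℕ} (hN : 0 < N) (hs : s ≤ N) :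
    (1 : ℝ) ≤ (N + 1) * (N.choose s * (((s : ℝ) / N) ^ s * (1 - (s : ℝ) / N) ^ (N - s))) := by
  have hsum : N ^ N ≤ (N + 1) * (N.choose s * s ^ s * (N - s) ^ (N - s)) := by
    calc N ^ N = (s + (N - s)) ^ N := by rw [Nat.add_sub_cancel' hs]
      _ = ∑ j ∈ Finset.range (N + 1), s ^ j * (N - s) ^ (N - j) * N.choose j := by
        rw [add_pow]; simp
      _ ≤ ∑ _j ∈ Finset.range (N + 1), N.choose s * s ^ s * (N - s) ^ (N - s) := by
        refine Finset.sum_le_sum fun j hj => ?_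
        have := choose_mul_pow_mul_pow_le hs (Nat.lt_succ_iff.mp (Finset.mem_range.mp hj))
        calc _ = N.choose j * s ^ j * (N - s) ^ (N - j) := by ring
          _ ≤ _ := this
      _ = _ := by simp
  have hNR : (0 : ℝ) < N := by exact_mod_cast hN
  have hcast : (N : ℝ) ^ N ≤ (N + 1) * (N.choose s * (s : ℝ) ^ s * ((N : ℝ) - s) ^ (N - s)) := by
    have : ((N ^ N : ℕ) : ℝ) ≤ ((N + 1) * (N.choose s * s ^ s * (N - s) ^ (N - s)) : ℕ) := by
      exact_mod_cast hsum
    push_cast [Nat.cast_sub hs] at this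
    exact this
  have hpow : (N : ℝ) ^ N = (N : ℝ) ^ s * (N : ℝ) ^ (N - s) := by
    rw [← pow_add, Nat.add_sub_cancel' hs]
  rw [one_sub_div hNR.ne', div_pow, div_pow, div_mul_div_comm, ← hpow, mul_div_assoc',
    mul_div_assoc', one_le_div (by positivity)]
  calc _ ≤ _ := hcast
    _ = _ := by ring

/-! ### Costs of clusterings -/

theorem infDist_mem_Icc_diam {V : Type*} [MetricSpace V] [Fintype V] {k : ℕ} (hk : 1 ≤ k)
    (C : Centers V k) (v : V) :
    Metric.infDist v (C.1 : Set V) ∈ Set.Icc 0 (Metric.diam (Set.univ : Set V)) := by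
  refine ⟨Metric.infDist_nonneg, ?_⟩
  obtain ⟨y, hy⟩ : C.1.Nonempty := Finset.card_pos.mp (by rw [C.2]; omega)
  exact (Metric.infDist_le_dist_of_mem (Finset.mem_coe.mpr hy)).trans
    (Metric.dist_le_diam_of_mem Set.finite_univ.isBounded (Set.mem_univ _) (Set.mem_univ _))

theorem card_mul_costAvg {V : Type*} [MetricSpace V] {k : ℕ} {U : Finset V} (hU : U.Nonempty)
    (C : Centers V k) :
    U.card * costAvg U C = ∑ v ∈ U, Metric.infDist v (C.1 : Set V) := by
  have : (U.card : ℝ) ≠ 0 := by exact_mod_cast hU.card_pos.ne'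
  rw [costAvg]
  field_simp

theorem costAvg_nonneg {V : Type*} [MetricSpace V] {k : ℕ} (U : Finset V) (C : Centers V k) :
    0 ≤ costAvg U C :=
  mul_nonneg (by positivity) (Finset.sum_nonneg fun _ _ => Metric.infDist_nonneg)

theorem costAvg_le_diam {V : Type*} [MetricSpace V] [Fintype V] {k : ℕ} (hk : 1 ≤ k)
    (U : Finset V) (C : Centers V k) : costAvg U C ≤ Metric.diam (Set.univ : Set V) := by
  rcases U.eq_empty_or_nonempty with rfl | hU
  · simpa [costAvg] using Metric.diam_nonneg
  · have hpos : (0 : ℝ) < U.card := by exact_mod_cast hU.card_pos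
    refine le_of_mul_le_mul_left ?_ hpos
    rw [card_mul_costAvg hU]
    simpa using Finset.sum_le_card_nsmul U _ _ fun v _ => (infDist_mem_Icc_diam hk C v).2

theorem medAvg_nonneg {V : Type*} [MetricSpace V] (U : Finset V) (k : ℕ) : 0 ≤ medAvg U k :=
  mul_nonneg (by positivity) (Real.iInf_nonneg fun _ =>
    Finset.sum_nonneg fun _ _ => Metric.infDist_nonneg)

theorem medAvg_le_costAvg {V : Type*} [MetricSpace V] [Fintype V] {k : ℕ} (U : Finset V)
    (C : Centers V k) : medAvg U k ≤ costAvg U C :=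
  mul_le_mul_of_nonneg_left (ciInf_le (Set.finite_range _).bddBelow C) (by positivity)

theorem exists_costAvg_eq_medAvg {V : Type*} [MetricSpace V] [Fintype V] {k : ℕ}
    [Nonempty (Centers V k)] (U : Finset V) : ∃ C : Centers V k, costAvg U C = medAvg U k := by
  obtain ⟨C, hC⟩ := exists_eq_ciInf_of_finite
    (f := fun C : Centers V k => ∑ x ∈ U, Metric.infDist x (C.1 : Set V))
  exact ⟨C, by rw [costAvg, medAvg, ← hC]⟩

/-! ### Representative samples -/

/-- A sample `S` of `D` is `t`-representative if it is nonempty and for every choice of `k` centers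
the average costs on `S` and on `D` differ by at most `t`. -/
structure RepresentativeSample {V : Type*} [MetricSpace V] (k : ℕ) (t : ℝ) (D S : Finset V) :
    Prop where
  nonempty : S.Nonempty
  abs_sub_le : ∀ C : Centers V k, |costAvg S C - costAvg D C| ≤ t

theorem RepresentativeSample.costAvg_le {V : Type*} [MetricSpace V] [Fintype V] {k : ℕ}
    {t α γ : ℝ} {D S : Finset V} (hS : RepresentativeSample k t D S) (hα : 0 ≤ α)
    {C : Centers V k} (hC : IsGoodSolution α γ S C) :
    costAvg D C ≤ α * medAvg D k + γ + (1 + α) * t := by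
  have : Nonempty (Centers V k) := ⟨C⟩
  obtain ⟨C₀, hC₀⟩ := exists_costAvg_eq_medAvg (k := k) D
  have h1 := (abs_le.mp (hS.abs_sub_le C)).1
  have h2 := (abs_le.mp (hS.abs_sub_le C₀)).2
  have h3 := mul_le_mul_of_nonneg_left
    ((medAvg_le_costAvg S C₀).trans (show _ ≤ medAvg D k + t by linarith)) hα
  rw [IsGoodSolution] at hC
  linarith

/-- If a sample is not representative, some centers have a positive or negative deviation. -/
theorem exists_deviation_of_not_representativeSample {V : Type*} [MetricSpace V] {k : ℕ}
    [Nonempty (Centers V k)] {t : ℝ} {D S : Finset V} (h : ¬ RepresentativeSample k t D S) :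
    ∃ C : Centers V k,
      t * S.card ≤ ∑ v ∈ S, (Metric.infDist v (C.1 : Set V) - costAvg D C) ∨
      t * S.card ≤ ∑ v ∈ S, -(Metric.infDist v (C.1 : Set V) - costAvg D C) := by
  rcases S.eq_empty_or_nonempty with rfl | hS
  · exact ⟨Classical.arbitrary _, Or.inl (by simp)⟩
  · have hpos : (0 : ℝ) < S.card := by exact_mod_cast hS.card_pos
    obtain ⟨C, hC⟩ : ∃ C : Centers V k, t < |costAvg S C - costAvg D C| := by
      by_contra! hcon
      exact h ⟨hS, hcon⟩
    refine ⟨C, ?_⟩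
    rw [Finset.sum_neg_distrib, Finset.sum_sub_distrib, ← card_mul_costAvg hS, Finset.sum_const,
      nsmul_eq_mul]
    rcases lt_abs.mp hC with h | h
    · left; nlinarith
    · right; nlinarith

theorem Finset.sum_biUnion_le_of_nonneg {ι α : Type*} [DecidableEq α] (s : Finset ι)
    (u : ι → Finset α) {f : α → ℝ} (hf : ∀ a, 0 ≤ f a) :
    ∑ a ∈ s.biUnion u, f a ≤ ∑ i ∈ s, ∑ a ∈ u i, f a := by
  classical
  induction s using Finset.induction_on with
  | empty => simp
  | insert i s hi ih =>
    rw [Finset.biUnion_insert, Finset.sum_insert hi]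
    have h1 := Finset.sum_union_inter (f := f) (s₁ := u i) (s₂ := s.biUnion u)
    have h2 := Finset.sum_nonneg fun a (_ : a ∈ u i ∩ s.biUnion u) => hf a
    linarith

open Classical in
/-- The union bound over all choices of centers and both signs of the deviation. -/
theorem sum_sampleWeight_not_representativeSample_le {V : Type*} [MetricSpace V] [Fintype V]
    {k : ℕ} [Nonempty (Centers V k)] (hk : 1 ≤ k) {p : ℝ} (hp : p ∈ Set.Icc (0 : ℝ) 1)
    {D : Finset V} (hD : D.Nonempty) {t : ℝ} (ht : 0 < t)
    (htM : t ≤ Metric.diam (Set.univ : Set V)) :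
    ∑ S ∈ D.powerset with ¬ RepresentativeSample k t D S, sampleWeight p D S ≤
      2 * (Fintype.card V : ℝ) ^ k *
        Real.exp (-(p * D.card * t ^ 2 / (16 * Metric.diam (Set.univ : Set V) ^ 2))) := by
  set M := Metric.diam (Set.univ : Set V)
  set B := Real.exp (-(p * D.card * t ^ 2 / (16 * M ^ 2)))
  let h : Centers V k → V → ℝ := fun C v => Metric.infDist v (C.1 : Set V) - costAvg D C
  have habs : ∀ C v, |h C v| ≤ M := by
    intro C v
    have h1 := infDist_mem_Icc_diam hk C v
    have h2 := costAvg_nonneg D C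
    have h3 := costAvg_le_diam hk D C
    exact abs_le.mpr ⟨by linarith [h1.1], by linarith [h1.2]⟩
  have hzero : ∀ C, ∑ v ∈ D, h C v = 0 := by
    intro C
    simp only [h]
    rw [Finset.sum_sub_distrib, ← card_mul_costAvg hD, Finset.sum_const, nsmul_eq_mul, sub_self]
  have hcover : (D.powerset.filter fun S => ¬ RepresentativeSample k t D S) ⊆
      Finset.univ.biUnion fun C : Centers V k =>
        (D.powerset.filter fun S => t * S.card ≤ ∑ v ∈ S, h C v) ∪
          (D.powerset.filter fun S => t * S.card ≤ ∑ v ∈ S, -h C v) := by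
    intro S hS
    rw [Finset.mem_filter] at hS
    obtain ⟨C, hC⟩ := exists_deviation_of_not_representativeSample hS.2
    rw [Finset.mem_biUnion]
    refine ⟨C, Finset.mem_univ _, ?_⟩
    rw [Finset.mem_union, Finset.mem_filter, Finset.mem_filter]
    exact hC.imp (fun h => ⟨hS.1, h⟩) (fun h => ⟨hS.1, h⟩)
  have hcard : (Fintype.card (Centers V k) : ℝ) ≤ (Fintype.card V : ℝ) ^ k := by
    rw [Fintype.card_finset_len]
    exact_mod_cast Nat.choose_le_pow _ _
  have hw := fun S : Finset V => sampleWeight_nonneg hp D S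
  calc _ ≤ ∑ S ∈ _, sampleWeight p D S :=
        Finset.sum_le_sum_of_subset_of_nonneg hcover fun S _ _ => hw S
    _ ≤ ∑ C : Centers V k, ∑ S ∈ (D.powerset.filter fun S => t * S.card ≤ ∑ v ∈ S, h C v) ∪
          (D.powerset.filter fun S => t * S.card ≤ ∑ v ∈ S, -h C v), sampleWeight p D S :=
        Finset.sum_biUnion_le_of_nonneg _ _ hw
    _ ≤ ∑ _C : Centers V k, 2 * B := by
        refine Finset.sum_le_sum fun C _ => ?_
        have h1 := sum_sampleWeight_deviation_le hp D (h C) ht htM (fun v _ => habs C v) (hzero C)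
        have h2 := sum_sampleWeight_deviation_le hp D (fun v => -h C v) ht htM
          (fun v _ => by rw [abs_neg]; exact habs C v)
          (by rw [Finset.sum_neg_distrib, hzero C, neg_zero])
        have h3 := Finset.sum_union_inter (f := sampleWeight p D)
          (s₁ := D.powerset.filter fun S => t * S.card ≤ ∑ v ∈ S, h C v)
          (s₂ := D.powerset.filter fun S => t * S.card ≤ ∑ v ∈ S, -h C v)
        have h4 := Finset.sum_nonneg fun S (_ : S ∈
          (D.powerset.filter fun S => t * S.card ≤ ∑ v ∈ S, h C v) ∩
          (D.powerset.filter fun S => t * S.card ≤ ∑ v ∈ S, -h C v)) => hw S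
        linarith
    _ = Fintype.card (Centers V k) * (2 * B) := by
        rw [Finset.sum_const, nsmul_eq_mul, Finset.card_univ]
    _ ≤ (Fintype.card V : ℝ) ^ k * (2 * B) := by gcongr
    _ = _ := by ring

/-! ### Sample sizes -/

/-- The factor `n + 1` is the price of conditioning on the size of the sample; it and the factor `2`
are absorbed into `k * log n`, because `n ≥ 2` and `k ≥ 1`. -/
theorem two_mul_pow_mul_exp_le {n k : ℕ} (hn : 2 ≤ n) (hk : 1 ≤ k) {M η θ x : ℝ} (hη : 0 < η)
    (hM : 0 < M) (hθ : 0 < θ) (hx : 3136 * sampleBound M η θ n k ≤ x) (hθ1 : θ < 1) :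
    (n + 1) * (2 * (n : ℝ) ^ k * Real.exp (-(x * (η / 7) ^ 2 / (16 * M ^ 2)))) ≤ θ := by
  have hn0 : (0 : ℝ) < n := by positivity
  have hn2 : (2 : ℝ) ≤ n := by exact_mod_cast hn
  have hk1 : (1 : ℝ) ≤ k := by exact_mod_cast hk
  have hlog0 : 0 ≤ Real.log n := Real.log_nonneg (by linarith)
  have hlogk : Real.log n ≤ k * Real.log n := le_mul_of_one_le_left hlog0 hk1
  have hlog2 : Real.log 2 ≤ Real.log n := Real.log_le_log (by norm_num) hn2
  have hlogn : Real.log (n + 1) ≤ 2 * Real.log n := by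
    rw [← Real.log_rpow hn0]
    refine Real.log_le_log (by positivity) ?_
    norm_num
    nlinarith
  have hθlog : 0 ≤ Real.log (1 / θ) := Real.log_nonneg (one_le_one_div hθ hθ1.le)
  have hx' : 4 * (k * Real.log n + Real.log (1 / θ)) ≤ x * (η / 7) ^ 2 / (16 * M ^ 2) := by
    have h1 : 3136 * ((M / η) ^ 2 * (k * Real.log n + Real.log (1 / θ))) ≤ x :=
      (mul_le_mul_of_nonneg_left (le_max_right _ _) (by norm_num)).trans hx
    calc 4 * (k * Real.log n + Real.log (1 / θ))
        = 3136 * ((M / η) ^ 2 * (k * Real.log n + Real.log (1 / θ))) *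
            ((η / 7) ^ 2 / (16 * M ^ 2)) := by field_simp; ring
      _ ≤ x * ((η / 7) ^ 2 / (16 * M ^ 2)) := by gcongr
      _ = _ := by ring
  calc _ = Real.exp (Real.log (n + 1) + Real.log 2 + k * Real.log n -
        x * (η / 7) ^ 2 / (16 * M ^ 2)) := by
        rw [sub_eq_add_neg, Real.exp_add, Real.exp_add, Real.exp_add,
          Real.exp_log (by positivity), Real.exp_log (by norm_num), Real.exp_nat_mul,
          Real.exp_log hn0]
        ring
    _ ≤ Real.exp (-Real.log (1 / θ)) := Real.exp_le_exp.mpr (by linarith)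
    _ = θ := by rw [one_div, Real.log_inv, neg_neg, Real.exp_log hθ]

/-- All samples of a given size have the same weight, so their conditional distribution may be
studied under the inclusion probability `s / |D|` instead of `ξ`. -/
theorem sum_sampleWeight_card_eq_le {V : Type*} {D : Finset V} {s : ℕ} (hs : 0 < s)
    (hsD : s ≤ D.card) {b : ℝ} {P : Finset V → Prop} [DecidablePred P]
    (hP : ∑ S ∈ D.powerset with P S, sampleWeight ((s : ℝ) / D.card) D S ≤ b)
    {ξ : ℝ} (hξ : ξ ∈ Set.Icc (0 : ℝ) 1) :
    ∑ S ∈ D.powerset with S.card = s ∧ P S, sampleWeight ξ D S ≤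
      ((D.card + 1) * b) * ∑ S ∈ D.powerset with S.card = s, sampleWeight ξ D S := by
  have hN : 0 < D.card := hs.trans_le hsD
  have hNR : (0 : ℝ) < D.card := by exact_mod_cast hN
  have hp : (s : ℝ) / D.card ∈ Set.Icc (0 : ℝ) 1 :=
    ⟨by positivity, (div_le_one hNR).mpr (by exact_mod_cast hsD)⟩
  set p := (s : ℝ) / D.card with hpdef
  set F := D.powerset.filter fun S => S.card = s ∧ P S
  have hconst : ∀ q : ℝ, ∑ S ∈ F, sampleWeight q D S =
      F.card * (q ^ s * (1 - q) ^ (D.card - s)) := by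
    intro q
    rw [← nsmul_eq_mul, ← Finset.sum_const]
    refine Finset.sum_congr rfl fun S hS => ?_
    rw [sampleWeight, (Finset.mem_filter.mp hS).2.1]
  have hall : ∑ S ∈ D.powerset with S.card = s, sampleWeight ξ D S =
      D.card.choose s * (ξ ^ s * (1 - ξ) ^ (D.card - s)) := by
    rw [← Finset.powersetCard_eq_filter, ← Finset.card_powersetCard, ← nsmul_eq_mul,
      ← Finset.sum_const]
    refine Finset.sum_congr rfl fun S hS => ?_
    rw [sampleWeight, (Finset.mem_powersetCard.mp hS).2]
  have hb : F.card * (p ^ s * (1 - p) ^ (D.card - s)) ≤ b := by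
    rw [← hconst]
    refine le_trans (Finset.sum_le_sum_of_subset_of_nonneg ?_ fun S _ _ =>
      sampleWeight_nonneg hp D S) hP
    exact fun S hS => Finset.mem_filter.mpr
      ⟨(Finset.mem_filter.mp hS).1, (Finset.mem_filter.mp hS).2.2⟩
  have hmode := one_le_card_succ_mul_binomial hN hsD
  rw [← hpdef] at hmode
  have hw0 : 0 ≤ p ^ s * (1 - p) ^ (D.card - s) :=
    mul_nonneg (pow_nonneg hp.1 _) (pow_nonneg (sub_nonneg.mpr hp.2) _)
  set w := p ^ s * (1 - p) ^ (D.card - s)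
  have hw : 0 < w := by
    refine hw0.lt_of_ne fun h => ?_
    rw [← h] at hmode
    norm_num at hmode
  have hcard : (F.card : ℝ) ≤ (D.card + 1) * b * D.card.choose s := by
    refine le_of_mul_le_mul_right ?_ hw
    have hb0 : 0 ≤ b := (by positivity : (0 : ℝ) ≤ F.card * w).trans hb
    nlinarith [mul_le_mul_of_nonneg_left hmode hb0]
  rw [hconst, hall, ← mul_assoc ((D.card + 1) * b)]
  exact mul_le_mul_of_nonneg_right hcard
    (mul_nonneg (pow_nonneg hξ.1 _) (pow_nonneg (sub_nonneg.mpr hξ.2) _))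

/-! ### Accuracy of the sampling scheme -/

open Classical in
/-- If among the samples with property `Q` all but a proportion `θ` are representative, then
conditionally on `Q` the output is good for `D` except with probability `θ + β`. -/
theorem le_samplingRun_of_representativeSample {V : Type*} [MetricSpace V] [Fintype V] {k : ℕ}
    {t α γ β θ : ℝ} (hα : 0 ≤ α) (hβ : 0 ≤ β) (hθ : 0 ≤ θ) {A : Finset V → PMF (Centers V k)}
    (hA : IsApproxAlgorithm α γ β A) {ξ : ℝ} (hξ : ξ ∈ Set.Icc (0 : ℝ) 1) (D : Finset V)
    (Q : Finset V → Prop) [DecidablePred Q]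
    (hQ : ∑ S ∈ D.powerset with Q S ∧ ¬ RepresentativeSample k t D S, sampleWeight ξ D S ≤
      θ * ∑ S ∈ D.powerset with Q S, sampleWeight ξ D S) :
    ENNReal.ofReal (1 - θ - β) * (samplingRun A ξ hξ D).toOuterMeasure {p | Q p.1} ≤
      (samplingRun A ξ hξ D).toOuterMeasure
        {p | Q p.1 ∧ costAvg D p.2 ≤ α * medAvg D k + γ + (1 + α) * t} := by
  rcases le_or_gt (1 - θ - β) 0 with hneg | hpos
  · rw [ENNReal.ofReal_of_nonpos hneg, zero_mul]
    exact zero_le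
  rw [samplingRun_toOuterMeasure, samplingRun_toOuterMeasure, ← ENNReal.ofReal_mul hpos.le]
  apply ENNReal.ofReal_le_ofReal
  have hw := fun S : Finset V => sampleWeight_nonneg hξ D S
  have hgood : ∀ S : Finset V, RepresentativeSample k t D S → 1 - β ≤
      (A S).realProb {C | costAvg D C ≤ α * medAvg D k + γ + (1 + α) * t} := by
    intro S hS
    refine (ENNReal.ofReal_le_ofReal_iff (PMF.realProb_nonneg _ _)).mp ?_
    rw [PMF.ofReal_realProb]
    exact (hA S).trans (MeasureTheory.measure_mono fun C hC => hS.costAvg_le hα hC)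
  have hleft : ∑ S ∈ D.powerset, sampleWeight ξ D S * (A S).realProb {C | (S, C) ∈
      {p : Finset V × Centers V k | Q p.1}} ≤ ∑ S ∈ D.powerset with Q S, sampleWeight ξ D S := by
    rw [Finset.sum_filter]
    refine Finset.sum_le_sum fun S _ => ?_
    by_cases h : Q S
    · rw [if_pos h]
      refine mul_le_of_le_one_right (hw S) ?_
      exact ENNReal.toReal_le_of_le_ofReal zero_le_one
        (by simpa using (A S).toOuterMeasure_apply_le_one _)
    · simp [h, PMF.realProb]
  have hright : (1 - β) * ∑ S ∈ D.powerset with Q S ∧ RepresentativeSample k t D S,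
      sampleWeight ξ D S ≤ ∑ S ∈ D.powerset, sampleWeight ξ D S * (A S).realProb {C | (S, C) ∈
        {p : Finset V × Centers V k |
          Q p.1 ∧ costAvg D p.2 ≤ α * medAvg D k + γ + (1 + α) * t}} := by
    rw [Finset.mul_sum, Finset.sum_filter]
    refine Finset.sum_le_sum fun S _ => ?_
    split_ifs with h
    · rw [mul_comm]
      refine mul_le_mul_of_nonneg_left ?_ (hw S)
      simpa [h.1] using hgood S h.2
    · exact mul_nonneg (hw S) (PMF.realProb_nonneg _ _)
  have hsplit : ∑ S ∈ D.powerset with Q S, sampleWeight ξ D S =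
      ∑ S ∈ D.powerset with Q S ∧ RepresentativeSample k t D S, sampleWeight ξ D S +
        ∑ S ∈ D.powerset with Q S ∧ ¬ RepresentativeSample k t D S, sampleWeight ξ D S := by
    rw [← Finset.sum_filter_add_sum_filter_not _ (RepresentativeSample k t D),
      Finset.filter_filter, Finset.filter_filter]
  have hQ0 : 0 ≤ ∑ S ∈ D.powerset with Q S, sampleWeight ξ D S :=
    Finset.sum_nonneg fun S _ => hw S
  set q := ∑ S ∈ D.powerset with Q S, sampleWeight ξ D S
  calc _ ≤ (1 - θ - β) * q := mul_le_mul_of_nonneg_left hleft hpos.le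
    _ ≤ (1 - β) * ((1 - θ) * q) := by
        nlinarith [mul_nonneg (mul_nonneg hβ hθ) hQ0]
    _ ≤ (1 - β) * ∑ S ∈ D.powerset with Q S ∧ RepresentativeSample k t D S,
          sampleWeight ξ D S := mul_le_mul_of_nonneg_left (by linarith) (by linarith)
    _ ≤ _ := hright

theorem samplingRun_setOf_card_eq_of_card_lt {V Ω : Type*} (A : Finset V → PMF Ω) {ξ : ℝ}
    (hξ : ξ ∈ Set.Icc (0 : ℝ) 1) {D : Finset V} {s : ℕ} (hs : D.card < s) :
    (samplingRun A ξ hξ D).toOuterMeasure {p | p.1.card = s} = 0 := by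
  rw [samplingRun_toOuterMeasure, Finset.sum_eq_zero, ENNReal.ofReal_zero]
  intro S hS
  have : S.card ≠ s := ((Finset.card_le_card (Finset.mem_powerset.mp hS)).trans_lt hs).ne
  simp [this, PMF.realProb]

theorem mainTheorem6 :
    ∃ c : ℝ, 0 < c ∧
      ∀ (V : Type*) [MetricSpace V] [Fintype V] (M : ℝ) (n k : ℕ),
        M = Metric.diam (Set.univ : Set V) → n = Fintype.card V → 1 ≤ k →
      ∀ (ε K β η θ ξ : ℝ), 0 < ε → 0 ≤ K → 0 ≤ β → 0 < η → 0 < θ → θ < 1 →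
      ∀ (hξ : ξ ∈ Set.Icc (0 : ℝ) 1) (A : Finset V → PMF (Centers V k)),
        IsDifferentiallyPrivate ε A →
        IsApproxAlgorithm 6 (K * (M * (k : ℝ) ^ 2 * Real.log (n / ε) ^ 2)) β A →
        -- privacy
        IsDifferentiallyPrivate (amplifiedEps ε ξ) (samplingAlgorithm A ξ hξ) ∧
        ∀ D : Finset V,
          -- accuracy, when the expected sample size is large enough
          (c * sampleBound M η θ n k ≤ ξ * D.card →
            ENNReal.ofReal (1 - θ - β) ≤
              (samplingAlgorithm A ξ hξ D).toOuterMeasure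
                {C | costAvg D C ≤ 6 * medAvg D k
                  + K * (M * (k : ℝ) ^ 2 * Real.log (n / ε) ^ 2) + η}) ∧
          -- accuracy, conditionally on a sample of a given size that is large enough
          (∀ s : ℕ, c * sampleBound M η θ n k ≤ s →
            ENNReal.ofReal (1 - θ - β) *
                (samplingRun A ξ hξ D).toOuterMeasure {p | p.1.card = s} ≤
              (samplingRun A ξ hξ D).toOuterMeasure
                {p | p.1.card = s ∧ costAvg D p.2 ≤ 6 * medAvg D k
                  + K * (M * (k : ℝ) ^ 2 * Real.log (n / ε) ^ 2) + η}) := by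

  classical
  refine ⟨3136, by norm_num, ?_⟩
  rintro V _ _ M n k rfl rfl hk ε K β η θ ξ _ hK hβ hη hθ hθ1 hξ A hDP hA
  refine ⟨isDifferentiallyPrivate_samplingAlgorithm hDP hξ, fun D => ?_⟩
  set M := Metric.diam (Set.univ : Set V) with hMdef
  set n := Fintype.card V with hndef
  obtain ⟨γ, hγ⟩ : ∃ γ, γ = K * (M * (k : ℝ) ^ 2 * Real.log (n / ε) ^ 2) := ⟨_, rfl⟩
  rw [← hγ] at hA ⊢
  have hM0 : 0 ≤ M := Metric.diam_nonneg
  have hγ0 : 0 ≤ γ := by rw [hγ]; positivity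
  -- The published output is the marginal of the run.
  have hmarginal : (samplingAlgorithm A ξ hξ D).toOuterMeasure
      {C | costAvg D C ≤ 6 * medAvg D k + γ + η} = (samplingRun A ξ hξ D).toOuterMeasure
        {p | True ∧ costAvg D p.2 ≤ 6 * medAvg D k + γ + η} := by
    simp only [samplingAlgorithm, PMF.toOuterMeasure_map_apply, true_and]
    rfl
  have htotal : (samplingRun A ξ hξ D).toOuterMeasure {_p | True} = 1 := by
    rw [PMF.toOuterMeasure_apply_eq_one_iff]
    exact fun _ _ => trivial
  rw [hmarginal]
  rcases lt_or_ge M η with hMη | hηM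
  · have hall : ∀ C : Centers V k, costAvg D C ≤ 6 * medAvg D k + γ + η := fun C => by
      have h1 := costAvg_le_diam hk D C
      have h2 := medAvg_nonneg D k
      linarith
    have hle : ENNReal.ofReal (1 - θ - β) ≤ 1 :=
      ENNReal.ofReal_le_one.mpr (by linarith)
    refine ⟨fun _ => ?_, fun s _ => ?_⟩
    · simp only [hall, and_true]
      rwa [htotal]
    · simp only [hall, and_true]
      exact mul_le_of_le_one_left zero_le hle
  have hMpos : 0 < M := hη.trans_le hηM
  have hcenters : Nonempty (Centers V k) := (A ∅).support_nonempty.to_type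
  have hn : 2 ≤ n := by
    by_contra! hlt
    have : Subsingleton V := Fintype.card_le_one_iff_subsingleton.mp (by omega)
    exact hMpos.ne' (Metric.diam_subsingleton Set.subsingleton_univ)
  have ht : 0 < η / 7 := by positivity
  have htM : η / 7 ≤ M := by linarith
  have hbound : 0 < sampleBound M η θ n k := by
    refine lt_of_lt_of_le ?_ (le_max_right _ _)
    have h1 : 0 < Real.log n := Real.log_pos (by exact_mod_cast hn)
    have h2 : 0 ≤ Real.log (1 / θ) := Real.log_nonneg (one_le_one_div hθ hθ1.le)
    have h3 : (0 : ℝ) < k := by exact_mod_cast hk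
    positivity
  have hη7 : (1 + 6) * (η / 7) = η := by ring
  constructor
  · intro hx
    have hD : D.Nonempty := by
      rw [Finset.nonempty_iff_ne_empty]
      rintro rfl
      rw [Finset.card_empty, Nat.cast_zero, mul_zero] at hx
      linarith
    have hbad := sum_sampleWeight_not_representativeSample_le hk hξ hD ht htM
    have hnum := two_mul_pow_mul_exp_le hn hk hη hMpos hθ hx hθ1
    have h := le_samplingRun_of_representativeSample (t := η / 7) (by norm_num) hβ hθ.le hA hξ D
      (fun _ => True) (by
        simp only [true_and, Finset.filter_true, sum_sampleWeight, mul_one]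
        refine hbad.trans (le_trans (le_mul_of_one_le_left (by positivity) ?_) hnum)
        linarith [(Nat.cast_nonneg n : (0 : ℝ) ≤ n)])
    rw [htotal, mul_one, hη7] at h
    exact h
  · intro s hx
    rcases lt_or_ge D.card s with hsD | hsD
    · rw [samplingRun_setOf_card_eq_of_card_lt A hξ hsD, mul_zero]
      exact zero_le
    have hs : 0 < s := by
      have : (0 : ℝ) < s := by linarith
      exact_mod_cast this
    have hDR : (0 : ℝ) < D.card := by exact_mod_cast hs.trans_le hsD
    have hD : D.Nonempty := Finset.card_pos.mp (hs.trans_le hsD)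
    have hp : (s : ℝ) / D.card ∈ Set.Icc (0 : ℝ) 1 :=
      ⟨by positivity, (div_le_one hDR).mpr (by exact_mod_cast hsD)⟩
    have hbad := sum_sampleWeight_not_representativeSample_le hk hp hD ht htM
    rw [div_mul_cancel₀ _ hDR.ne'] at hbad
    have hnum := two_mul_pow_mul_exp_le hn hk hη hMpos hθ hx hθ1
    have hcond := sum_sampleWeight_card_eq_le
      (P := fun S => ¬ RepresentativeSample k (η / 7) D S) hs hsD hbad hξ
    have hDn : (D.card : ℝ) ≤ n := by exact_mod_cast Finset.card_le_univ D
    have h := le_samplingRun_of_representativeSample (t := η / 7) (by norm_num) hβ hθ.le hA hξ D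
      (fun S => S.card = s) (by
        refine hcond.trans (mul_le_mul_of_nonneg_right (le_trans ?_ hnum)
          (Finset.sum_nonneg fun S _ => sampleWeight_nonneg hξ D S))
        gcongr)
    rw [hη7] at h
    exact h
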